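/- Setting. (Classical coefficients.) Let $\gamma$ be real and positive, let $a_1,\Sigma_+,S_+,d,f,g'$ be complex variables, $\Sigma_-=\Sigma_+^*$, $S_-=S_+^*$, $n_1=a_1^*a_1$. The polynomials $P_n,b_n$ ($n\ge1$) in $\gamma^{\pm1}$, these variables and their conjugates are the coefficients of the expansion $a_2=\sum_{n\ge1}P_na_1^2/n_1^{2n}$, $\beta=\sum_{n\ge1}b_n/n_1^{2n}$ of the solution of $$a_2=\frac{a_1^2}{n_1^2}\Big(-z+\frac{S_+}{\gamma}(1+\beta)\Big),\quad \beta=a_2^*a_2\gamma^2-\tfrac12\beta^2,\quad z=\Sigma_++f^*a_2^*+g'^*a_2+d^*a_2^{*2}+\tfrac12d\,a_2a_2^*,$$ that is, $P_1=-\Sigma_++S_+/\gamma$, $b_1=0$, and for $n>1$ $$P_n=-f^*a_1^{*2}P_{n-1}^*-g'^*a_1^2P_{n-1}-d^*a_1^{*4}\sum_{m=1}^{n-2}P_{n-m-1}^*P_m^*-\tfrac12d\,a_1^{*2}a_1^2\sum_{m=1}^{n-2}P_{n-m-1}P_m^*+\frac{S_+}{\gamma}b_{n-1},$$ $$b_n=a_1^{*2}a_1^2\gamma^2\sum_{m=1}^{n-1}P_{n-m}^*P_m-\tfrac12\sum_{m=1}^{n-1}b_{n-m}b_m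 .$$ (Quantum operators.) Consider oscillators with modes $k\in\mathbb Z\setminus\{0,2,-2\}$ and occupation numbers $n_k$. The operators $a_k$ satisfy $[a_k,a_l^+]=k\,\delta_{kl}$, all other commutators being zero; $a_k$ annihilates a quantum of mode $k$ if $k>0$ and creates one if $k<0$. Put $L_0^{(2)}=\sum_k|k|n_k$. The state space is spanned by the orthonormal states $|\{n_k\}\rangle\otimes|S\,S_3\,S^3\rangle$ with $S\in\{0,1,2,\dots\}$ and $S_3,S^3\in\{-S,\dots,S\}$, finitely many $n_k$ being nonzero. $S_\pm$ changes $S_3$ to $S_3\mp1$ with matrix element $\sqrt{S(S+1)-S_3(S_3\mp1)}$. With all summation indices in $\mathbb Z\setminus\{0,2,-2\}$, $$\Sigma_+=\tfrac12\sum_{i+j=k}\tfrac{k}{ij}a_i^+a_j^+a_k,\quad \Sigma_-=\Sigma_+^+,\quad d_+=\tfrac12a_4^+,\quad d_-=\tfrac12a_{-4}^+,\quad f_\pm=\pm\sum_{k=j\pm2}\tfrac{k}{2j}a_k^+a_j,$$ $$g'_-=\sum_{i+j=2,\ (i,j)\ne(1,1)}\tfrac1{ij}a_ia_j,\qquad g_+=-\sum_{i+j=-2}\tfrac1{ij}a_ia_j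 ,$$ and $d=d_+-d_-$, $f=f_+-f_-$, $g'=g'_--g_+$. Let $c_1,c_2$ be real, $c_2>0$ and $c_1\notin\{0,-1,-2,\dots\}$; put $\gamma=(L_0^{(2)}+c_2)^{-1/2}$ and $\tilde n_1=a_1^+a_1+c_1$. The elementary operators are $a_1,\ d_\pm,\ f_\pm,\ g'_-,\ g_+$, their adjoints, $\Sigma_\pm,\ S_\pm,\ \gamma,\ \gamma^{-1}$. The normally ordered operator $:P_n:$ is obtained by expanding $P_n$ into monomials in the elementary operators (conjugates becoming adjoints) and ordering each monomial by one fixed linear order of the elementary operators in which, from left to right, operators raising $L_0^{(2)}$ come first, then those preserving it, then those lowering it, and $S_+$ stands to the left of $S_-$. The quantum series is $\alpha_2=\sum_{n\ge1}\tilde n_1^{-2n+1}:P_n:$. Lemma. For every such order, all integers $N_1,N_2,S\ge0$ and every $n$ with $$n>\min\Big\{1+\frac{N_1+N_2}2,\ \frac{4+2(N_1+N_2)+4S}5\Big\},$$ all matrix elements of $:P_n:$ between states with $L_0^{(2)}=N_1$ and spin $S$ and states with $L_0^{(2)}=N_2$ and spin $S$ vanish: $\langle L_0^{(2)}=N_1,S|:P_n:|L_0^{(2)}=N_2,S\rangle=0$.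 Consequently, at fixed level cutoff $N$ and fixed spin $S$ the series for $\alpha_2$ truncates: if $n>\min\{1+N,\ (4+4N+4S)/5\}$, then all matrix elements of $\tilde n_1^{-2n+1}:P_n:$ between states with $L_0^{(2)}\le N$ and spin $S$ vanish. -/

import Mathlib

namespace LCString

/-! ### Classical expansion coefficients -/

/-- Classical variables: `a₁, a₁*, Σ₊, Σ₋ = Σ₊*, S₊, S₋ = S₊*, d, d*, f, f*, g', g'*, γ, γ⁻¹`. -/
inductive PVar
  | a1 | a1s | sigP | sigM | sP | sM | d | ds | f | fs | g | gs | gam | gamInv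
  deriving DecidableEq

/-- Complex conjugation of the classical variables (`γ` is real). -/
def PVar.conj : PVar → PVar
  | a1 => a1s | a1s => a1 | sigP => sigM | sigM => sigP | sP => sM | sM => sP
  | d => ds | ds => d | f => fs | fs => f | g => gs | gs => g
  | gam => gam | gamInv => gamInv

/-- Polynomials in the classical variables; all coefficients that occur are rational. -/
abbrev Poly := MvPolynomial PVar ℚ

/-- Complex conjugation of a polynomial with rational coefficients. -/
noncomputable def conjP (p : Poly) : Poly := MvPolynomial.rename PVar.conj p

/-- The pair `(P_n, b_n)` of coefficients of the formal solution
`a₂ = ∑_{n ≥ 1} P_n a₁² / n₁^{2n}`, `β = ∑_{n ≥ 1} b_n / n₁^{2n}` (with `n₁ = a₁* a₁`) of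
`a₂ = (a₁² / n₁²) (-z + (S₊/γ) (1 + β))`, `β = a₂* a₂ γ² - β² / 2`, where
`z = Σ₊ + f* a₂* + g'* a₂ + d* a₂*² + d a₂ a₂* / 2`.
In the clause `n + 2` the two arguments in a product of the first two sums run over the pairs of
positive integers with sum `n + 1`, in the last two sums over those with sum `n + 2`. -/
noncomputable def coeffs : ℕ → Poly × Poly
  | 0 => (0, 0)
  | 1 => (-MvPolynomial.X .sigP + MvPolynomial.X .sP * MvPolynomial.X .gamInv, 0)
  | n + 2 =>
    (- MvPolynomial.X .fs * MvPolynomial.X .a1s ^ 2 * conjP (coeffs (n + 1)).1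
      - MvPolynomial.X .gs * MvPolynomial.X .a1 ^ 2 * (coeffs (n + 1)).1
      - MvPolynomial.X .ds * MvPolynomial.X .a1s ^ 4 *
          ∑ m : Fin n, conjP (coeffs (n - m.1)).1 * conjP (coeffs (m.1 + 1)).1
      - MvPolynomial.C (1 / 2) * MvPolynomial.X .d * MvPolynomial.X .a1s ^ 2 *
          MvPolynomial.X .a1 ^ 2 *
          ∑ m : Fin n, (coeffs (n - m.1)).1 * conjP (coeffs (m.1 + 1)).1
      + MvPolynomial.X .sP * MvPolynomial.X .gamInv * (coeffs (n + 1)).2,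
     MvPolynomial.X .a1s ^ 2 * MvPolynomial.X .a1 ^ 2 * MvPolynomial.X .gam ^ 2 *
          ∑ m : Fin (n + 1), conjP (coeffs (n + 1 - m.1)).1 * (coeffs (m.1 + 1)).1
      - MvPolynomial.C (1 / 2) *
          ∑ m : Fin (n + 1), (coeffs (n + 1 - m.1)).2 * (coeffs (m.1 + 1)).2)
termination_by n => n
decreasing_by
  all_goals omega

/-- The classical polynomial `P_n` (`n ≥ 1`; the value at `n = 0` is `0`). -/
noncomputable def P (n : ℕ) : Poly := (coeffs n).1

/-! ### State space -/

/-- Labels of the independent oscillators: the modes `0, 2, -2` are absent. -/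
abbrev Mode := {k : ℤ // k ≠ 0 ∧ k ≠ 2 ∧ k ≠ -2}

/-- Labels of the orthonormal basis `|{n_k}⟩ |S S₃ S³⟩`: occupation numbers, the (integer) spin
`S`, and the lower-index and upper-index spin projections. -/
structure Label where
  occ : Mode →₀ ℕ
  S : ℕ
  lower : ℤ
  upper : ℤ
  hl : -(S : ℤ) ≤ lower ∧ lower ≤ S
  hu : -(S : ℤ) ≤ upper ∧ upper ≤ S

/-- The states: finite linear combinations of basis states. -/
abbrev Space := Label →₀ ℂ

/-- Linear operators on the state space. -/
abbrev Op := Module.End ℂ Space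

/-- The basis vector with a given label. -/
noncomputable def ket (s : Label) : Space := Finsupp.single s 1

/-- The Hermitian form for which the basis is orthonormal, antilinear in the first argument. -/
noncomputable def braket (φ ψ : Space) : ℂ := φ.sum fun s c => star c * ψ s

/-- The operator with prescribed values on the basis. -/
noncomputable def ofBasis (v : Label → Space) : Op := Finsupp.linearCombination ℂ v

/-- The diagonal operator with prescribed eigenvalues. -/
noncomputable def diag (x : Label → ℝ) : Op := ofBasis fun s => (x s : ℂ) • ket s

/-- The sum of a family of operators, taken on each basis vector. For the families below only
finitely many terms are nonzero on each basis vector, see the lemmas `…_finite`. -/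
noncomputable def sumOp {ι : Type} (T : ι → Op) : Op := ofBasis fun s => ∑ᶠ i, T i (ket s)

/-- The eigenvalue of `L₀⁽²⁾ = ∑ |k| n_k`. -/
def Label.L0 (s : Label) : ℕ := s.occ.sum fun k n => k.1.natAbs * n

/-- The states with `L₀⁽²⁾ = N` and spin `S`. -/
noncomputable def level (N S : ℕ) : Submodule ℂ Space :=
  Finsupp.supported ℂ ℂ {s | s.L0 = N ∧ s.S = S}

/-- The states with `L₀⁽²⁾ ≤ N` and spin `S`. -/
noncomputable def cutoff (N S : ℕ) : Submodule ℂ Space :=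
  Finsupp.supported ℂ ℂ {s | s.L0 ≤ N ∧ s.S = S}

/-! ### Oscillator and spin operators -/

/-- Normalised annihilation operator of the mode `k`. -/
noncomputable def annih (k : Mode) : Op := ofBasis fun s =>
  (Real.sqrt (s.occ k) : ℂ) • ket { s with occ := s.occ - Finsupp.single k 1 }

/-- Normalised creation operator of the mode `k`. -/
noncomputable def creat (k : Mode) : Op := ofBasis fun s =>
  (Real.sqrt (s.occ k + 1) : ℂ) • ket { s with occ := s.occ + Finsupp.single k 1 }

/-- The operator `a_k`, with `[a_k, a_k⁺] = k`: it lowers `L₀⁽²⁾` by `k` and the angular momentum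
`A₃⁽²⁾ = ∑ sign(k) n_k` by `1`; so it annihilates a quantum if `k > 0` and creates one if
`k < 0`. -/
noncomputable def a (k : Mode) : Op :=
  (Real.sqrt |(k.1 : ℝ)| : ℂ) • if 0 < k.1 then annih k else creat k

/-- The adjoint `a_k⁺` of `a_k`. -/
noncomputable def aDag (k : Mode) : Op :=
  (Real.sqrt |(k.1 : ℝ)| : ℂ) • if 0 < k.1 then creat k else annih k

/-- The modes `1, 4, -4`. -/
def m1 : Mode := ⟨1, by decide⟩
def m4 : Mode := ⟨4, by decide⟩
def mNeg4 : Mode := ⟨-4, by decide⟩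

/-- `S₊` lowers `S₃` by one. -/
noncomputable def spinPlus : Op := ofBasis fun s =>
  if h : -(s.S : ℤ) ≤ s.lower - 1 ∧ s.lower - 1 ≤ s.S then
    (Real.sqrt ((s.S : ℝ) * (s.S + 1) - s.lower * (s.lower - 1)) : ℂ) •
      ket { s with lower := s.lower - 1, hl := h }
  else 0

/-- `S₋` raises `S₃` by one. -/
noncomputable def spinMinus : Op := ofBasis fun s =>
  if h : -(s.S : ℤ) ≤ s.lower + 1 ∧ s.lower + 1 ≤ s.S then
    (Real.sqrt ((s.S : ℝ) * (s.S + 1) - s.lower * (s.lower + 1)) : ℂ) •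
      ket { s with lower := s.lower + 1, hl := h }
  else 0

/-! ### Elementary operators

The cubic sum `½ ∑_{i+j=k} (k/(ij)) a_i* a_j* a_k` over nonzero integers `i, j, k`, restricted by
the gauge condition `a₋₂ = -a₂`, is
`Σ₊ + f* a₂* + (a₁*² + g'*) a₂ + d* a₂*² + ½ d a₂ a₂*` with the following `Σ₊, d, f, g'`. All
factors in each of the products below commute. -/

/-- `∑_{k=j+δ} (k/(2j)) a_k⁺ a_j`. -/
noncomputable def fTerm (δ : ℤ) (p : {p : Mode × Mode // p.2.1 = p.1.1 + δ}) : Op :=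
  ((p.1.2.1 : ℂ) / (2 * p.1.1.1)) • (aDag p.1.2 * a p.1.1)
noncomputable def fSum (δ : ℤ) : Op := sumOp (fTerm δ)

/-- The adjoint of `fSum δ`. -/
noncomputable def fTermDag (δ : ℤ) (p : {p : Mode × Mode // p.2.1 = p.1.1 + δ}) : Op :=
  ((p.1.2.1 : ℂ) / (2 * p.1.1.1)) • (aDag p.1.1 * a p.1.2)
noncomputable def fSumDag (δ : ℤ) : Op := sumOp (fTermDag δ)

/-- `∑_{i+j=δ} (1/(ij)) a_i a_j` without the term `a₁²`. -/
noncomputable def gTerm (δ : ℤ)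
    (p : {p : Mode × Mode // p.1.1 + p.2.1 = δ ∧ ¬(p.1.1 = 1 ∧ p.2.1 = 1)}) : Op :=
  (1 / ((p.1.1.1 : ℂ) * p.1.2.1)) • (a p.1.1 * a p.1.2)
noncomputable def gSum (δ : ℤ) : Op := sumOp (gTerm δ)

/-- The adjoint of `gSum δ`. -/
noncomputable def gTermDag (δ : ℤ)
    (p : {p : Mode × Mode // p.1.1 + p.2.1 = δ ∧ ¬(p.1.1 = 1 ∧ p.2.1 = 1)}) : Op :=
  (1 / ((p.1.1.1 : ℂ) * p.1.2.1)) • (aDag p.1.1 * aDag p.1.2)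
noncomputable def gSumDag (δ : ℤ) : Op := sumOp (gTermDag δ)

/-- `Σ₊ = ½ ∑_{i+j=k} (k/(ij)) a_i⁺ a_j⁺ a_k`. -/
noncomputable def sigTermP
    (p : {p : Mode × Mode × Mode // p.1.1 + p.2.1.1 = p.2.2.1}) : Op :=
  ((p.1.2.2.1 : ℂ) / (2 * (p.1.1.1 * p.1.2.1.1))) • (aDag p.1.1 * aDag p.1.2.1 * a p.1.2.2)
noncomputable def sigmaPlus : Op := sumOp sigTermP

/-- `Σ₋ = Σ₊⁺`. -/
noncomputable def sigTermM
    (p : {p : Mode × Mode × Mode // p.1.1 + p.2.1.1 = p.2.2.1}) : Op :=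
  ((p.1.2.2.1 : ℂ) / (2 * (p.1.1.1 * p.1.2.1.1))) • (aDag p.1.2.2 * a p.1.1 * a p.1.2.1)
noncomputable def sigmaMinus : Op := sumOp sigTermM

/-- The elementary operators; `Dag` marks the adjoint. The primitive variables are
`d = d₊ - d₋`, `f = f₊ - f₋`, `g' = g'₋ - g₊`. -/
inductive Elem
  | a1 | a1Dag | sigP | sigM | sP | sM
  | dP | dM | dPDag | dMDag | fP | fM | fPDag | fMDag | gP | gM | gPDag | gMDag
  | gam | gamInv
  deriving DecidableEq

/-- The amount by which an elementary operator raises `L₀⁽²⁾`. -/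
def Elem.charge : Elem → ℤ
  | a1 => -1 | a1Dag => 1 | sigP => 0 | sigM => 0 | sP => 0 | sM => 0
  | dP => 4 | dM => -4 | dPDag => -4 | dMDag => 4
  | fP => 2 | fM => -2 | fPDag => -2 | fMDag => 2
  | gP => 2 | gM => -2 | gPDag => -2 | gMDag => 2
  | gam => 0 | gamInv => 0

/-- The operators denoted by the symbols; `γ = (L₀⁽²⁾ + c₂)^{-1/2}`. -/
noncomputable def Elem.op (c₂ : ℝ) : Elem → Op
  | a1 => a m1
  | a1Dag => aDag m1
  | sigP => sigmaPlus
  | sigM => sigmaMinus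
  | sP => spinPlus
  | sM => spinMinus
  | dP => (1 / 2 : ℂ) • aDag m4
  | dM => (1 / 2 : ℂ) • aDag mNeg4
  | dPDag => (1 / 2 : ℂ) • a m4
  | dMDag => (1 / 2 : ℂ) • a mNeg4
  | fP => fSum 2
  | fM => -fSum (-2)
  | fPDag => fSumDag 2
  | fMDag => -fSumDag (-2)
  | gP => -gSum (-2)
  | gM => gSum 2
  | gPDag => -gSumDag (-2)
  | gMDag => gSumDag 2
  | gam => diag fun s => (Real.sqrt (s.L0 + c₂))⁻¹
  | gamInv => diag fun s => Real.sqrt (s.L0 + c₂)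

/-! ### Normal ordering -/

/-- Expression of the classical variables through the elementary ones. -/
noncomputable def PVar.expand : PVar → MvPolynomial Elem ℚ
  | a1 => MvPolynomial.X .a1
  | a1s => MvPolynomial.X .a1Dag
  | sigP => MvPolynomial.X .sigP
  | sigM => MvPolynomial.X .sigM
  | sP => MvPolynomial.X .sP
  | sM => MvPolynomial.X .sM
  | d => MvPolynomial.X .dP - MvPolynomial.X .dM
  | ds => MvPolynomial.X .dPDag - MvPolynomial.X .dMDag
  | f => MvPolynomial.X .fP - MvPolynomial.X .fM
  | fs => MvPolynomial.X .fPDag - MvPolynomial.X .fMDag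
  | g => MvPolynomial.X .gM - MvPolynomial.X .gP
  | gs => MvPolynomial.X .gMDag - MvPolynomial.X .gPDag
  | gam => MvPolynomial.X .gam
  | gamInv => MvPolynomial.X .gamInv

/-- An ordering rule lists every elementary operator once, from left to right in a product:
first the `L₀⁽²⁾`-raising operators, then the neutral ones, then the lowering ones, and `S₊` to
the left of `S₋`. -/
def IsNormalOrdering (l : List Elem) : Prop :=
  l.Nodup ∧ (∀ x, x ∈ l) ∧
    l.Pairwise (fun x y => SignType.sign y.charge ≤ SignType.sign x.charge) ∧
    l.Pairwise (fun x y => ¬(x = Elem.sM ∧ y = Elem.sP))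

/-- The product of the operators in a monomial, ordered by `l`. -/
noncomputable def orderedMonomial (c₂ : ℝ) (l : List Elem) (e : Elem →₀ ℕ) : Op :=
  (l.map fun x => x.op c₂ ^ e x).prod

/-- The normally ordered operator `:p:`: each monomial in the elementary operators is ordered
by `l`. -/
noncomputable def normalOrdered (c₂ : ℝ) (l : List Elem) (p : Poly) : Op :=
  let q : MvPolynomial Elem ℚ := MvPolynomial.aeval PVar.expand p
  ∑ e ∈ q.support, ((q.coeff e : ℚ) : ℂ) • orderedMonomial c₂ l e

/-- The `n`-th term `ñ₁^{-2n+1} :P_n:` (`n ≥ 1`) of the quantum series for `α₂`, where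
`ñ₁ = a₁⁺ a₁ + c₁`. -/
noncomputable def alphaTerm (c₁ c₂ : ℝ) (l : List Elem) (n : ℕ) : Op :=
  diag (fun s => (((s.occ m1 : ℝ) + c₁) ^ (2 * n - 1))⁻¹) * normalOrdered c₂ l (P n)

/-! ### The definitions make sense -/

theorem exists_isNormalOrdering : ∃ l, IsNormalOrdering l := by
  refine ⟨[.a1Dag, .dP, .dMDag, .fP, .fMDag, .gP, .gMDag, .gam, .gamInv, .sigP, .sigM, .sP, .sM,
    .gM, .gPDag, .fM, .fPDag, .dM, .dPDag, .a1], by decide, fun x => by cases x <;> decide,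
    by decide, by decide⟩

theorem ofBasis_ket (v : Label → Space) (s : Label) : ofBasis v (ket s) = v s := by
  simp [ofBasis, ket]

/-- The states in which the mode `k` is not occupied. -/
noncomputable def unocc (k : Mode) : Submodule ℂ Space :=
  Finsupp.supported ℂ ℂ {s | s.occ k = 0}

theorem ket_mem_unocc {k : Mode} {s : Label} (h : s.occ k = 0) : ket s ∈ unocc k :=
  Finsupp.single_mem_supported ℂ 1 h

theorem ofBasis_mem {k : Mode} {v : Label → Space} {W : Submodule ℂ Space}
    (hv : ∀ s : Label, s.occ k = 0 → v s ∈ W) {φ : Space} (hφ : φ ∈ unocc k) :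
    ofBasis v φ ∈ W := by
  rw [ofBasis, Finsupp.linearCombination_apply]
  exact Submodule.sum_mem _ fun s hs =>
    W.smul_mem _ (hv s ((Finsupp.mem_supported ℂ φ).1 hφ hs))

theorem annih_eq_zero {k : Mode} {φ : Space} (hφ : φ ∈ unocc k) : annih k φ = 0 := by
  have := ofBasis_mem (W := ⊥) (v := fun s => (Real.sqrt (s.occ k) : ℂ) •
    ket { s with occ := s.occ - Finsupp.single k 1 }) (fun s hs => by simp [hs]) hφ
  simpa [annih] using this

theorem annih_mem {j k : Mode} {φ : Space} (hφ : φ ∈ unocc k) : annih j φ ∈ unocc k :=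
  ofBasis_mem (fun s hs => Submodule.smul_mem _ _ (ket_mem_unocc (by simp [hs]))) hφ

theorem creat_mem {j k : Mode} (hjk : j ≠ k) {φ : Space} (hφ : φ ∈ unocc k) :
    creat j φ ∈ unocc k :=
  ofBasis_mem (fun s hs => Submodule.smul_mem _ _
    (ket_mem_unocc (by simp [hs, hjk]))) hφ

theorem a_eq_zero {k : Mode} (hk : 0 < k.1) {φ : Space} (hφ : φ ∈ unocc k) : a k φ = 0 := by
  simp [a, hk, annih_eq_zero hφ]

theorem aDag_eq_zero {k : Mode} (hk : k.1 < 0) {φ : Space} (hφ : φ ∈ unocc k) :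
    aDag k φ = 0 := by
  simp [aDag, not_lt.2 hk.le, annih_eq_zero hφ]

theorem a_mem {j k : Mode} (h : j ≠ k ∨ 0 < j.1) {φ : Space} (hφ : φ ∈ unocc k) :
    a j φ ∈ unocc k := by
  unfold a
  split_ifs with hj
  · exact Submodule.smul_mem _ _ (annih_mem hφ)
  · exact Submodule.smul_mem _ _ (creat_mem (h.resolve_right hj) hφ)

theorem aDag_mem {j k : Mode} (h : j ≠ k ∨ j.1 < 0) {φ : Space} (hφ : φ ∈ unocc k) :
    aDag j φ ∈ unocc k := by
  unfold aDag
  split_ifs with hj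
  · exact Submodule.smul_mem _ _ (creat_mem (h.resolve_right (not_lt.2 hj.le)) hφ)
  · exact Submodule.smul_mem _ _ (annih_mem hφ)

theorem exists_bound (s : Label) : ∃ B : ℤ, 0 ≤ B ∧ ∀ k : Mode, B < |k.1| → s.occ k = 0 := by
  refine ⟨∑ k ∈ s.occ.support, |k.1|, Finset.sum_nonneg fun _ _ => abs_nonneg _, fun k hk => ?_⟩
  by_contra h
  exact absurd (Finset.single_le_sum (f := fun k : Mode => |k.1|) (fun _ _ => abs_nonneg _)
    (Finsupp.mem_support_iff.2 h)) (not_le.2 hk)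

theorem finite_box (B : ℤ) : {k : Mode | |k.1| ≤ B}.Finite := by
  refine Set.Finite.of_finite_image (f := Subtype.val) ((Set.finite_Icc (-B) B).subset ?_)
    Subtype.val_injective.injOn
  rintro _ ⟨k, hk, rfl⟩
  exact abs_le.1 hk

theorem finite_pairs {p : Mode × Mode → Prop} (A : Set (Subtype p)) (B : ℤ)
    (h : ∀ x ∈ A, |x.1.1.1| ≤ B ∧ |x.1.2.1| ≤ B) : A.Finite := by
  refine Set.Finite.of_finite_image (f := Subtype.val)
    (((finite_box B).prod (finite_box B)).subset ?_) Subtype.val_injective.injOn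
  rintro _ ⟨x, hx, rfl⟩
  exact h x hx

theorem fTerm_finite (δ : ℤ) (hδ : δ ≠ 0) (s : Label) :
    (Function.support fun p => fTerm δ p (ket s)).Finite := by
  obtain ⟨B, hB, hs⟩ := exists_bound s
  refine finite_pairs _ (B + |δ|) ?_
  rintro ⟨⟨j, k⟩, hp⟩ hx
  simp only at hp
  have hne : j ≠ k := fun e => hδ (by rw [e] at hp; omega)
  have h1 : 0 < j.1 → ¬ B < |j.1| := fun h0 h => hx (by
    simp [fTerm, a_eq_zero h0 (ket_mem_unocc (hs j h))])
  have h2 : k.1 < 0 → ¬ B < |k.1| := fun h0 h => hx (by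
    simp [fTerm, aDag_eq_zero h0 (a_mem (.inl hne) (ket_mem_unocc (hs k h)))])
  simp only
  grind

theorem fTermDag_finite (δ : ℤ) (hδ : δ ≠ 0) (s : Label) :
    (Function.support fun p => fTermDag δ p (ket s)).Finite := by
  obtain ⟨B, hB, hs⟩ := exists_bound s
  refine finite_pairs _ (B + |δ|) ?_
  rintro ⟨⟨j, k⟩, hp⟩ hx
  simp only at hp
  have hne : k ≠ j := fun e => hδ (by rw [e] at hp; omega)
  have h1 : 0 < k.1 → ¬ B < |k.1| := fun h0 h => hx (by
    simp [fTermDag, a_eq_zero h0 (ket_mem_unocc (hs k h))])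
  have h2 : j.1 < 0 → ¬ B < |j.1| := fun h0 h => hx (by
    simp [fTermDag, aDag_eq_zero h0 (a_mem (.inl hne) (ket_mem_unocc (hs j h)))])
  simp only
  grind

theorem gTerm_finite (δ : ℤ) (s : Label) :
    (Function.support fun p => gTerm δ p (ket s)).Finite := by
  obtain ⟨B, hB, hs⟩ := exists_bound s
  refine finite_pairs _ (B + |δ|) ?_
  rintro ⟨⟨i, j⟩, hp, hp'⟩ hx
  simp only at hp
  have h1 : 0 < j.1 → ¬ B < |j.1| := fun h0 h => hx (by
    simp [gTerm, a_eq_zero h0 (ket_mem_unocc (hs j h))])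
  have h2 : 0 < i.1 → ¬ B < |i.1| := fun h0 h => hx (by
    have : j ≠ i ∨ 0 < j.1 := by
      by_cases e : j = i
      · exact .inr (e ▸ h0)
      · exact .inl e
    simp [gTerm, a_eq_zero h0 (a_mem this (ket_mem_unocc (hs i h)))])
  simp only
  grind

theorem gTermDag_finite (δ : ℤ) (s : Label) :
    (Function.support fun p => gTermDag δ p (ket s)).Finite := by
  obtain ⟨B, hB, hs⟩ := exists_bound s
  refine finite_pairs _ (B + |δ|) ?_
  rintro ⟨⟨i, j⟩, hp, hp'⟩ hx
  simp only at hp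
  have h1 : j.1 < 0 → ¬ B < |j.1| := fun h0 h => hx (by
    simp [gTermDag, aDag_eq_zero h0 (ket_mem_unocc (hs j h))])
  have h2 : i.1 < 0 → ¬ B < |i.1| := fun h0 h => hx (by
    have : j ≠ i ∨ j.1 < 0 := by
      by_cases e : j = i
      · exact .inr (e ▸ h0)
      · exact .inl e
    simp [gTermDag, aDag_eq_zero h0 (aDag_mem this (ket_mem_unocc (hs i h)))])
  simp only
  grind

theorem finite_triples {p : Mode × Mode × Mode → Prop} (A : Set (Subtype p)) (B : ℤ)
    (h : ∀ x ∈ A, |x.1.1.1| ≤ B ∧ |x.1.2.1.1| ≤ B ∧ |x.1.2.2.1| ≤ B) : A.Finite := by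
  refine Set.Finite.of_finite_image (f := Subtype.val)
    (((finite_box B).prod ((finite_box B).prod (finite_box B))).subset ?_)
    Subtype.val_injective.injOn
  rintro _ ⟨x, hx, rfl⟩
  exact h x hx

theorem sigTermP_finite (s : Label) :
    (Function.support fun p => sigTermP p (ket s)).Finite := by
  obtain ⟨B, hB, hs⟩ := exists_bound s
  refine finite_triples _ (2 * B) ?_
  rintro ⟨⟨i, j, k⟩, hp⟩ hx
  simp only at hp
  have hi := i.2.1
  have hj := j.2.1
  have hki : k ≠ i := fun e => hj (by rw [e] at hp; omega)
  have hkj : k ≠ j := fun e => hi (by rw [e] at hp; omega)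
  have h1 : 0 < k.1 → ¬ B < |k.1| := fun h0 h => hx (by
    simp [sigTermP, a_eq_zero h0 (ket_mem_unocc (hs k h))])
  have h2 : j.1 < 0 → ¬ B < |j.1| := fun h0 h => hx (by
    simp [sigTermP, aDag_eq_zero h0 (a_mem (.inl hkj) (ket_mem_unocc (hs j h)))])
  have h3 : i.1 < 0 → ¬ B < |i.1| := fun h0 h => hx (by
    have : j ≠ i ∨ j.1 < 0 := by
      by_cases e : j = i
      · exact .inr (e ▸ h0)
      · exact .inl e
    simp [sigTermP, aDag_eq_zero h0
      (aDag_mem this (a_mem (.inl hki) (ket_mem_unocc (hs i h))))])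
  simp only
  grind

theorem sigTermM_finite (s : Label) :
    (Function.support fun p => sigTermM p (ket s)).Finite := by
  obtain ⟨B, hB, hs⟩ := exists_bound s
  refine finite_triples _ (2 * B) ?_
  rintro ⟨⟨i, j, k⟩, hp⟩ hx
  simp only at hp
  have hi := i.2.1
  have hj := j.2.1
  have hik : i ≠ k := fun e => hj (by rw [e] at hp; omega)
  have hjk : j ≠ k := fun e => hi (by rw [e] at hp; omega)
  have h1 : 0 < j.1 → ¬ B < |j.1| := fun h0 h => hx (by
    simp [sigTermM, a_eq_zero h0 (ket_mem_unocc (hs j h))])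
  have h2 : 0 < i.1 → ¬ B < |i.1| := fun h0 h => hx (by
    have : j ≠ i ∨ 0 < j.1 := by
      by_cases e : j = i
      · exact .inr (e ▸ h0)
      · exact .inl e
    simp [sigTermM, a_eq_zero h0 (a_mem this (ket_mem_unocc (hs i h)))])
  have h3 : k.1 < 0 → ¬ B < |k.1| := fun h0 h => hx (by
    simp [sigTermM, aDag_eq_zero h0
      (a_mem (.inl hik) (a_mem (.inl hjk) (ket_mem_unocc (hs k h))))])
  simp only
  grind

end LCString

/-! Two estimates on monomials collide. Give a symbol that shifts `L₀⁽²⁾` by `c` the weight `α|c|`,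
and each `Σ±` or `S±` the weight `ν`. If `ν ≤ 2α`, the recursion forces every monomial of `P_n` to
have weight at least `ν + (n-1)(2α+ν)` (`weightGE_coeffs`, `weightGE_P`): large `n` means many
shifts or many `Σ±`, `S±`.

Conversely, let a normally ordered monomial have a nonzero matrix element from level `N₂` to level
`N₁` at spin `S`, and let `R` and `L` be the total amounts raised and lowered. The lowering
operators act first, so the neutral ones act at the level `M = N₂ - L = N₁ - R ≥ 0`. Each `Σ±`
changes the angular momentum by `±1` at fixed `M`, and `|A₃⁽²⁾| ≤ L₀⁽²⁾`, so each of the two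
exponents is at most `2M`; those of `S±` are at most `2S` (`exponent_bounds`).

For `(α,ν) = (1,0)` this gives `2(n-1) ≤ R + L ≤ N₁ + N₂`. For `(2,1)` it gives `5n - 4 ≤ 2(R+L) +
4M + 4S = 2(N₁+N₂) + 4S`. These are the two entries of the minimum. -/

namespace LCString

/-! ### Lower bounds for the weights of monomials -/

section WeightBounds

variable {σ τ : Type*}

/-- Every monomial of `p` has weight at least `k`. -/
def WeightGE (w : σ → ℕ) (k : ℕ) (p : MvPolynomial σ ℚ) : Prop :=
  ∀ e, p.coeff e ≠ 0 → k ≤ Finsupp.weight w e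

namespace WeightGE

variable {w : σ → ℕ} {j k : ℕ} {p q : MvPolynomial σ ℚ}

theorem zero : WeightGE w k 0 := fun e he => absurd (MvPolynomial.coeff_zero e) he

theorem mono (hp : WeightGE w k p) (h : j ≤ k) : WeightGE w j p :=
  fun e he => h.trans (hp e he)

theorem add (hp : WeightGE w k p) (hq : WeightGE w k q) : WeightGE w k (p + q) := by
  intro e he
  rw [MvPolynomial.coeff_add] at he
  by_cases h : p.coeff e = 0
  · exact hq e fun h' => he (by rw [h, h', add_zero])
  · exact hp e h

theorem neg (hp : WeightGE w k p) : WeightGE w k (-p) :=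
  fun e he => hp e fun h => he (by rw [MvPolynomial.coeff_neg, h, neg_zero])

theorem sub (hp : WeightGE w k p) (hq : WeightGE w k q) : WeightGE w k (p - q) :=
  sub_eq_add_neg p q ▸ hp.add hq.neg

theorem sum {ι : Type*} {s : Finset ι} {f : ι → MvPolynomial σ ℚ}
    (h : ∀ i ∈ s, WeightGE w k (f i)) : WeightGE w k (∑ i ∈ s, f i) :=
  Finset.sum_induction f (WeightGE w k) (fun _ _ => add) zero h

theorem mul (hp : WeightGE w j p) (hq : WeightGE w k q) : WeightGE w (j + k) (p * q) := by
  classical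
  intro e he
  rw [MvPolynomial.coeff_mul] at he
  obtain ⟨x, hx, hne⟩ := Finset.exists_ne_zero_of_sum_ne_zero he
  rw [← Finset.HasAntidiagonal.mem_antidiagonal.1 hx, map_add]
  exact add_le_add (hp _ (left_ne_zero_of_mul hne)) (hq _ (right_ne_zero_of_mul hne))

theorem C (c : ℚ) : WeightGE w 0 (MvPolynomial.C c) := fun _ _ => Nat.zero_le _

theorem X (i : σ) : WeightGE w (w i) (MvPolynomial.X i) := by
  classical
  intro e he
  rw [MvPolynomial.coeff_X] at he
  obtain rfl : Finsupp.single i 1 = e := by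
    by_contra h
    exact he (if_neg h)
  simp [Finsupp.weight_single]

theorem pow (hp : WeightGE w k p) (n : ℕ) : WeightGE w (n * k) (p ^ n) := by
  induction n with
  | zero => exact fun _ _ => by simp
  | succ n ih =>
    rw [pow_succ, Nat.succ_mul]
    exact ih.mul hp

theorem prod_pow {w' : τ → ℕ} {g : σ → MvPolynomial τ ℚ} (hg : ∀ i, WeightGE w' (w i) (g i))
    (e : σ →₀ ℕ) : WeightGE w' (Finsupp.weight w e) (e.prod fun i n => g i ^ n) := by
  classical
  rw [Finsupp.weight_apply, Finsupp.sum, Finsupp.prod]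
  induction e.support using Finset.induction_on with
  | empty => exact fun _ _ => by simp
  | insert i s hi ih =>
    rw [Finset.sum_insert hi, Finset.prod_insert hi]
    exact ((hg i).pow _).mul ih

theorem aeval {w' : τ → ℕ} {g : σ → MvPolynomial τ ℚ} (hg : ∀ i, WeightGE w' (w i) (g i))
    (hp : WeightGE w k p) : WeightGE w' k (MvPolynomial.aeval g p) := by
  rw [MvPolynomial.aeval_def, MvPolynomial.eval₂_eq]
  refine sum fun e he => ?_
  have h := (C (w := w') (p.coeff e)).mul (prod_pow hg e)
  rw [zero_add] at h
  exact h.mono (hp e (MvPolynomial.mem_support_iff.1 he))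

end WeightGE

end WeightBounds

/-! ### Weights in the recursion for `P_n` and `b_n`. -/

/-- The weight of the classical variables that counts `α` for each unit of `L₀⁽²⁾` shifted and `ν`
for each `Σ±` and `S±`. -/
def PVar.weight (α ν : ℕ) : PVar → ℕ
  | a1 | a1s => α
  | f | fs | g | gs => 2 * α
  | d | ds => 4 * α
  | sigP | sigM | sP | sM => ν
  | gam | gamInv => 0

theorem WeightGE.conjP {α ν k : ℕ} {p : Poly} (hp : WeightGE (PVar.weight α ν) k p) :
    WeightGE (PVar.weight α ν) k (conjP p) := by
  rw [LCString.conjP, MvPolynomial.rename_eq_aeval]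
  refine hp.aeval fun i => ?_
  have h : PVar.weight α ν i = PVar.weight α ν i.conj := by cases i <;> rfl
  rw [h]
  exact WeightGE.X _

/-- The increment `2α + ν` per step is dictated by the pair of terms `S₊ b/γ` in `P_n` and `a₁*² a₁²
γ² P* P` in `b_n`, for which the bounds propagate with equality. The other terms of `P_n` have
weight to spare. Both bounds must be carried through the induction together. -/
theorem weightGE_coeffs {α ν : ℕ} (h : ν ≤ 2 * α) (n : ℕ) (hn : 0 < n) :
    WeightGE (PVar.weight α ν) (ν + (n - 1) * (2 * α + ν)) (coeffs n).1 ∧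
      WeightGE (PVar.weight α ν) (n * (2 * α + ν)) (coeffs n).2 := by
  induction n using Nat.strong_induction_on with
  | _ n ih =>
  match n, hn, ih with
  | 1, _, _ =>
    rw [coeffs]
    refine ⟨?_, .zero⟩
    have h1 := WeightGE.X (w := PVar.weight α ν) .sigP
    have h2 := (WeightGE.X (w := PVar.weight α ν) .sP).mul (.X .gamInv)
    exact (h1.neg.add h2).mono (by simp [PVar.weight])
  | n + 2, _, ih =>
    rw [coeffs]
    have X := WeightGE.X (w := PVar.weight α ν)
    obtain ⟨hP, hb⟩ := ih (n + 1) (by omega) (by omega)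
    have hP' (m : ℕ) (hm : m < n + 1) := (ih (m + 1) (by omega) (by omega)).1
    have hb' (m : ℕ) (hm : m < n + 1) := (ih (m + 1) (by omega) (by omega)).2
    simp only [Nat.add_sub_cancel] at hP hP'
    -- Total weight of a product of two `P`'s with indices `k + 1` and `m + 1`.
    have key (q : ℕ) (k m : ℕ) (hkm : k + m = q) :
        ν + k * (2 * α + ν) + (ν + m * (2 * α + ν)) = 2 * ν + q * (2 * α + ν) := by
      subst hkm; ring
    refine ⟨?_, ?_⟩
    · have t1 := (((X .fs).neg.mul ((X .a1s).pow 2)).mul hP.conjP)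
      have t2 := (((X .gs).mul ((X .a1).pow 2)).mul hP)
      -- For `n = 0` the sum is empty, so the truncated `n - 1` does no harm.
      have t3 : WeightGE (PVar.weight α ν) (2 * ν + (n - 1) * (2 * α + ν))
          (∑ m : Fin n, LCString.conjP (coeffs (n - m.1)).1 *
            LCString.conjP (coeffs (m.1 + 1)).1) := by
        refine .sum fun m _ => ?_
        have hm := m.2
        have := (hP' (n - m.1 - 1) (by omega)).conjP.mul (hP' m.1 (by omega)).conjP
        rw [key (n - 1) _ _ (by omega)] at this
        rwa [show n - m.1 - 1 + 1 = n - m.1 by omega] at this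
      have t4 : WeightGE (PVar.weight α ν) (2 * ν + (n - 1) * (2 * α + ν))
          (∑ m : Fin n, (coeffs (n - m.1)).1 * LCString.conjP (coeffs (m.1 + 1)).1) := by
        refine .sum fun m _ => ?_
        have hm := m.2
        have := (hP' (n - m.1 - 1) (by omega)).mul (hP' m.1 (by omega)).conjP
        rw [key (n - 1) _ _ (by omega)] at this
        rwa [show n - m.1 - 1 + 1 = n - m.1 by omega] at this
      have t3' := ((X .ds).mul ((X .a1s).pow 4)).mul t3
      have t4' := ((((WeightGE.C (1 / 2)).mul (X .d)).mul ((X .a1s).pow 2)).mul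
        ((X .a1).pow 2)).mul t4
      have t5 := ((X .sP).mul (X .gamInv)).mul hb
      have hn1 : (n + 1) * (2 * α + ν) ≤ (n - 1) * (2 * α + ν) + 2 * (2 * α + ν) := by
        rw [← add_mul]
        exact Nat.mul_le_mul_right _ (by omega)
      have e1 : (n + 1) * (2 * α + ν) = n * (2 * α + ν) + (2 * α + ν) := by ring
      -- The `f` and `g'` terms gain `4α ≥ 2α + ν`, which is exactly `ν ≤ 2α`; the `d` terms would
      -- only need `ν ≤ 4α`.
      refine ((((t1.mono ?_).sub (t2.mono ?_)).sub (t3'.mono ?_)).sub (t4'.mono ?_)).add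
        (t5.mono ?_) <;> simp only [PVar.weight,
          show n + 2 - 1 = n + 1 by omega] <;> omega
    · have t1 : WeightGE (PVar.weight α ν) (2 * ν + n * (2 * α + ν))
          (∑ m : Fin (n + 1), LCString.conjP (coeffs (n + 1 - m.1)).1 *
            (coeffs (m.1 + 1)).1) := by
        refine .sum fun m _ => ?_
        have hm := m.2
        have := (hP' (n - m.1) (by omega)).conjP.mul (hP' m.1 (by omega))
        rw [key n _ _ (by omega)] at this
        rwa [show n - m.1 + 1 = n + 1 - m.1 by omega] at this
      have t2 : WeightGE (PVar.weight α ν) ((n + 2) * (2 * α + ν))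
          (∑ m : Fin (n + 1), (coeffs (n + 1 - m.1)).2 * (coeffs (m.1 + 1)).2) := by
        refine .sum fun m _ => ?_
        have hm := m.2
        have := (hb' (n - m.1) (by omega)).mul (hb' m.1 (by omega))
        rw [← add_mul, show n - m.1 + 1 + (m.1 + 1) = n + 2 by omega] at this
        rwa [show n - m.1 + 1 = n + 1 - m.1 by omega] at this
      have t1' := ((((X .a1s).pow 2).mul ((X .a1).pow 2)).mul ((X .gam).pow 2)).mul t1
      have t2' := (WeightGE.C (1 / 2)).mul t2
      have e2 : (n + 2) * (2 * α + ν) = n * (2 * α + ν) + 2 * (2 * α + ν) := by ring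
      refine (t1'.mono ?_).sub (t2'.mono ?_) <;> simp only [PVar.weight, zero_add] <;> omega

/-- The weight of the elementary operators that corresponds to `PVar.weight`. -/
def Elem.weight (α ν : ℕ) (x : Elem) : ℕ :=
  α * x.charge.natAbs +
    ν * if x = sigP ∨ x = sigM ∨ x = sP ∨ x = sM then 1 else 0

/-- The two parts of each of `d`, `f`, `g'` and their conjugates shift `L₀⁽²⁾` by opposite amounts,
hence have equal weight. -/
theorem weightGE_expand (α ν : ℕ) (v : PVar) :
    WeightGE (Elem.weight α ν) (PVar.weight α ν v) v.expand := by
  have X := WeightGE.X (w := Elem.weight α ν)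
  cases v <;> simp only [PVar.expand]
  case d | ds | f | fs | g | gs =>
    exact ((X _).sub ((X _).mono (by simp [Elem.weight, Elem.charge]))).mono
      (by simp [Elem.weight, PVar.weight, Elem.charge, mul_comm])
  all_goals exact (X _).mono (by simp [Elem.weight, PVar.weight, Elem.charge])

theorem weightGE_P {α ν : ℕ} (h : ν ≤ 2 * α) (n : ℕ) :
    WeightGE (Elem.weight α ν) (ν + (n - 1) * (2 * α + ν))
      (MvPolynomial.aeval PVar.expand (P n)) := by
  rcases Nat.eq_zero_or_pos n with rfl | hn
  · rw [P, coeffs, map_zero]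
    exact .zero
  · exact (weightGE_coeffs h n hn).1.aeval (weightGE_expand α ν)

/-! ### Operators that shift a quantum number -/

/-- The operator `T` connects only basis states between which `q` increases by `c`. -/
def Shifts (q : Label → ℤ) (c : ℤ) (T : Op) : Prop :=
  ∀ t s, T (ket t) s ≠ 0 → q s = q t + c

theorem apply_eq_sum (T : Op) (ψ : Space) : T ψ = ψ.sum fun r c => c • T (ket r) := by
  conv_lhs => rw [← ψ.sum_single]
  rw [map_finsuppSum]
  refine Finsupp.sum_congr fun r _ => ?_
  rw [ket, ← map_smul, Finsupp.smul_single_one]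

/-- A matrix element of a product is a sum over intermediate basis states, so some path must
contribute. -/
theorem exists_intermediate {T U : Op} {t s : Label} (h : (T * U) (ket t) s ≠ 0) :
    ∃ r, U (ket t) r ≠ 0 ∧ T (ket r) s ≠ 0 := by
  rw [Module.End.mul_apply, apply_eq_sum T, Finsupp.sum_apply] at h
  obtain ⟨r, hr, hne⟩ := Finset.exists_ne_zero_of_sum_ne_zero h
  exact ⟨r, Finsupp.mem_support_iff.1 hr, right_ne_zero_of_mul hne⟩

theorem eq_of_ket_ne_zero {t s : Label} (h : ket t s ≠ 0) : s = t := by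
  classical
  by_contra hne
  exact h (Finsupp.single_eq_of_ne hne)

namespace Shifts

variable {q : Label → ℤ} {c d : ℤ} {T U : Op}

theorem one : Shifts q 0 1 := fun t s h => by
  rw [eq_of_ket_ne_zero h, add_zero]

theorem mul (hT : Shifts q c T) (hU : Shifts q d U) : Shifts q (c + d) (T * U) := by
  intro t s h
  obtain ⟨r, h1, h2⟩ := exists_intermediate h
  rw [hT _ _ h2, hU _ _ h1]
  ring

theorem pow (hT : Shifts q c T) (n : ℕ) : Shifts q (n * c) (T ^ n) := by
  induction n with
  | zero => simpa using one
  | succ n ih =>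
    rw [pow_succ]
    convert ih.mul hT using 1
    push_cast
    ring

theorem smul (hT : Shifts q c T) (x : ℂ) : Shifts q c (x • T) :=
  fun t s h => hT t s (right_ne_zero_of_mul h)

theorem neg (hT : Shifts q c T) : Shifts q c (-T) :=
  fun t s h => hT t s fun h' => h (by simp [h'])

theorem sumOp {ι : Type} {T : ι → Op} (hT : ∀ i, Shifts q c (T i)) :
    Shifts q c (sumOp T) := by
  intro t s h
  rw [LCString.sumOp, ofBasis_ket] at h
  by_cases hf : (Function.support fun i => T i (ket t)).Finite
  · rw [finsum_eq_sum _ hf, Finsupp.finsetSum_apply] at h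
    obtain ⟨i, _, hi⟩ := Finset.exists_ne_zero_of_sum_ne_zero h
    exact hT i t s hi
  -- The default value of an infinite `finsum` is `0`, so finiteness of the family need not be
  -- known.
  · rw [finsum_of_infinite_support hf] at h
    exact absurd rfl h

theorem ofBasis {x : Label → ℂ} {g : Label → Label} (h : ∀ t, x t ≠ 0 → q (g t) = q t + c) :
    Shifts q c (ofBasis fun t => x t • ket (g t)) := by
  intro t s hne
  rw [ofBasis_ket] at hne
  rw [eq_of_ket_ne_zero (right_ne_zero_of_mul hne)]
  exact h t (left_ne_zero_of_mul hne)

theorem diag (x : Label → ℝ) : Shifts q 0 (diag x) :=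
  ofBasis (x := fun t => (x t : ℂ)) (g := id) fun _ _ => (add_zero _).symm

end Shifts

/-! ### Additive quantum numbers of the elementary operators. -/

/-- The quantum number `∑ ω k * n_k`. -/
def Label.moment (ω : Mode → ℤ) (s : Label) : ℤ := s.occ.sum fun k n => n * ω k

theorem moment_add (ω : Mode → ℤ) (u v : Mode →₀ ℕ) :
    ((u + v).sum fun k n => (n : ℤ) * ω k) =
      (u.sum fun k n => (n : ℤ) * ω k) + v.sum fun k n => (n : ℤ) * ω k :=
  Finsupp.sum_add_index' (by simp) fun k m n => by push_cast; ring

theorem shifts_creat (ω : Mode → ℤ) (k : Mode) : Shifts (Label.moment ω) (ω k) (creat k) :=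
  .ofBasis (x := fun t => (Real.sqrt (t.occ k + 1) : ℂ)) fun t _ => by
    simp [Label.moment, moment_add]

theorem shifts_annih (ω : Mode → ℤ) (k : Mode) : Shifts (Label.moment ω) (-ω k) (annih k) := by
  refine .ofBasis (x := fun t => (Real.sqrt (t.occ k) : ℂ)) fun t ht => ?_
  -- The factor `√n_k` vanishes at `n_k = 0`, so the truncated subtraction only occurs where it is
  -- genuine.
  have h : Finsupp.single k 1 ≤ t.occ := by
    rw [Finsupp.single_le_iff]
    by_contra h0
    exact ht (by simp [show t.occ k = 0 by omega])
  have := moment_add ω (t.occ - Finsupp.single k 1) (Finsupp.single k 1)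
  rw [tsub_add_cancel_of_le h] at this
  simp only [Label.moment, this]
  simp

/-- If a quantum of mode `k` carries `c` for `k > 0` and `-c` for `k < 0`, then `a k` lowers the
total by `c`, whether it annihilates or creates. -/
theorem shifts_a {ω : Mode → ℤ} {k : Mode} {c : ℤ} (hp : 0 < k.1 → ω k = c)
    (hm : k.1 < 0 → ω k = -c) : Shifts (Label.moment ω) (-c) (a k) := by
  refine Shifts.smul ?_ _
  split_ifs with h
  · exact hp h ▸ shifts_annih ω k
  · exact hm (lt_of_le_of_ne (not_lt.1 h) k.2.1) ▸ shifts_creat ω k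

theorem shifts_aDag {ω : Mode → ℤ} {k : Mode} {c : ℤ} (hp : 0 < k.1 → ω k = c)
    (hm : k.1 < 0 → ω k = -c) : Shifts (Label.moment ω) c (aDag k) := by
  refine Shifts.smul ?_ _
  split_ifs with h
  · exact hp h ▸ shifts_creat ω k
  · have := shifts_annih ω k
    rwa [hm (lt_of_le_of_ne (not_lt.1 h) k.2.1), neg_neg] at this

/-- `L₀⁽²⁾` as an integer. -/
def Label.energy (s : Label) : ℤ := s.moment fun k => k.1.natAbs

theorem energy_eq (s : Label) : s.energy = s.L0 := by
  simp [Label.energy, Label.moment, Label.L0, Finsupp.sum, mul_comm]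

/-- The angular momentum `A₃⁽²⁾ = ∑ sign(k) n_k`. -/
def Label.angular (s : Label) : ℤ := s.moment fun k => k.1.sign

/-- A quantum of mode `k` carries angular momentum `±1` and contributes `|k| ≥ 1` to `L₀⁽²⁾`. -/
theorem abs_angular_le (s : Label) : |s.angular| ≤ s.energy := by
  refine (Finset.abs_sum_le_sum_abs _ _).trans (Finset.sum_le_sum fun k _ => ?_)
  rw [abs_mul, Nat.abs_cast]
  refine mul_le_mul_of_nonneg_left ?_ (Nat.cast_nonneg _)
  rw [Int.abs_sign_of_ne_zero k.2.1]
  have := k.2.1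
  simp only
  omega

theorem energy_a (k : Mode) : Shifts Label.energy (-k.1) (a k) :=
  shifts_a (by grind) (by grind)

theorem energy_aDag (k : Mode) : Shifts Label.energy k.1 (aDag k) :=
  shifts_aDag (by grind) (by grind)

theorem angular_a (k : Mode) : Shifts Label.angular (-1) (a k) :=
  shifts_a Int.sign_eq_one_of_pos Int.sign_eq_neg_one_of_neg

theorem angular_aDag (k : Mode) : Shifts Label.angular 1 (aDag k) :=
  shifts_aDag Int.sign_eq_one_of_pos Int.sign_eq_neg_one_of_neg

theorem spin_annih (k : Mode) : Shifts (fun s => s.S) 0 (annih k) :=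
  .ofBasis (x := fun t => (Real.sqrt (t.occ k) : ℂ)) fun _ _ => (add_zero _).symm

theorem spin_creat (k : Mode) : Shifts (fun s => s.S) 0 (creat k) :=
  .ofBasis (x := fun t => (Real.sqrt (t.occ k + 1) : ℂ)) fun _ _ => (add_zero _).symm

theorem spin_a (k : Mode) : Shifts (fun s => s.S) 0 (a k) := by
  refine Shifts.smul ?_ _
  split_ifs
  exacts [spin_annih k, spin_creat k]

theorem spin_aDag (k : Mode) : Shifts (fun s => s.S) 0 (aDag k) := by
  refine Shifts.smul ?_ _
  split_ifs
  exacts [spin_creat k, spin_annih k]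

/-- Stated for arbitrary `q` because it serves for `L₀⁽²⁾` and `S`, which are unchanged, and for
`S₃`, which moves. -/
theorem shifts_spinPlus {q : Label → ℤ} {c : ℤ}
    (h : ∀ (s : Label) (hl), q { s with lower := s.lower - 1, hl := hl } = q s + c) :
    Shifts q c spinPlus := by
  intro t s hne
  rw [spinPlus, ofBasis_ket] at hne
  split_ifs at hne with hl
  · rw [eq_of_ket_ne_zero (right_ne_zero_of_mul hne)]
    exact h t hl
  · exact absurd rfl hne

theorem shifts_spinMinus {q : Label → ℤ} {c : ℤ}
    (h : ∀ (s : Label) (hl), q { s with lower := s.lower + 1, hl := hl } = q s + c) :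
    Shifts q c spinMinus := by
  intro t s hne
  rw [spinMinus, ofBasis_ket] at hne
  split_ifs at hne with hl
  · rw [eq_of_ket_ne_zero (right_ne_zero_of_mul hne)]
    exact h t hl
  · exact absurd rfl hne

theorem Shifts.of_eq {q : Label → ℤ} {c d : ℤ} {T : Op} (h : Shifts q c T) (e : c = d) :
    Shifts q d T := e ▸ h

theorem angular_sigmaPlus : Shifts Label.angular 1 sigmaPlus :=
  .sumOp fun _ => .smul (((angular_aDag _).mul (angular_aDag _)).mul (angular_a _)) _

theorem angular_sigmaMinus : Shifts Label.angular (-1) sigmaMinus :=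
  .sumOp fun _ => .smul (((angular_aDag _).mul (angular_a _)).mul (angular_a _)) _

theorem spin_op (c₂ : ℝ) (x : Elem) : Shifts (fun s => s.S) 0 (x.op c₂) := by
  cases x
  case a1 => exact spin_a _
  case a1Dag => exact spin_aDag _
  case sigP => exact .sumOp fun _ => .smul (((spin_aDag _).mul (spin_aDag _)).mul (spin_a _)) _
  case sigM => exact .sumOp fun _ => .smul (((spin_aDag _).mul (spin_a _)).mul (spin_a _)) _
  case sP => exact shifts_spinPlus fun _ _ => (add_zero _).symm
  case sM => exact shifts_spinMinus fun _ _ => (add_zero _).symm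
  case dP | dM => exact .smul (spin_aDag _) _
  case dPDag | dMDag => exact .smul (spin_a _) _
  case fP | fPDag => exact .sumOp fun _ => .smul ((spin_aDag _).mul (spin_a _)) _
  case fM | fMDag => exact .neg (.sumOp fun _ => .smul ((spin_aDag _).mul (spin_a _)) _)
  case gP => exact .neg (.sumOp fun _ => .smul ((spin_a _).mul (spin_a _)) _)
  case gM => exact .sumOp fun _ => .smul ((spin_a _).mul (spin_a _)) _
  case gPDag => exact .neg (.sumOp fun _ => .smul ((spin_aDag _).mul (spin_aDag _)) _)
  case gMDag => exact .sumOp fun _ => .smul ((spin_aDag _).mul (spin_aDag _)) _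
  case gam | gamInv => exact .diag _

theorem energy_fSum (δ : ℤ) : Shifts Label.energy δ (fSum δ) :=
  .sumOp fun p => ((((energy_aDag _).mul (energy_a _))).smul _).of_eq (by have := p.2; omega)

theorem energy_fSumDag (δ : ℤ) : Shifts Label.energy (-δ) (fSumDag δ) :=
  .sumOp fun p => ((((energy_aDag _).mul (energy_a _))).smul _).of_eq (by have := p.2; omega)

theorem energy_gSum (δ : ℤ) : Shifts Label.energy (-δ) (gSum δ) :=
  .sumOp fun p => ((((energy_a _).mul (energy_a _))).smul _).of_eq (by have := p.2; omega)

theorem energy_gSumDag (δ : ℤ) : Shifts Label.energy δ (gSumDag δ) :=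
  .sumOp fun p => ((((energy_aDag _).mul (energy_aDag _))).smul _).of_eq
    (by have := p.2; omega)

theorem energy_op (c₂ : ℝ) (x : Elem) : Shifts Label.energy x.charge (x.op c₂) := by
  cases x
  case a1 => exact energy_a m1
  case a1Dag => exact energy_aDag m1
  case sigP =>
    exact .sumOp fun p => .of_eq (.smul (((energy_aDag _).mul (energy_aDag _)).mul (energy_a _)) _)
      (by have := p.2; simp only [Elem.charge]; omega)
  case sigM =>
    exact .sumOp fun p => .of_eq (.smul (((energy_aDag _).mul (energy_a _)).mul (energy_a _)) _)
      (by have := p.2; simp only [Elem.charge]; omega)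
  case sP => exact shifts_spinPlus fun _ _ => (add_zero _).symm
  case sM => exact shifts_spinMinus fun _ _ => (add_zero _).symm
  case dP => exact .smul (energy_aDag m4) _
  case dM => exact .smul (energy_aDag mNeg4) _
  case dPDag => exact .smul (energy_a m4) _
  case dMDag => exact .smul (energy_a mNeg4) _
  case fP => exact energy_fSum 2
  case fM => exact (energy_fSum (-2)).neg
  case fPDag => exact energy_fSumDag 2
  case fMDag => exact (energy_fSumDag (-2)).neg
  case gP => exact (energy_gSum (-2)).neg
  case gM => exact energy_gSum 2
  case gPDag => exact (energy_gSumDag (-2)).neg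
  case gMDag => exact energy_gSumDag 2
  case gam | gamInv => exact .diag _

/-! ### Bounds on the exponents -/

/-- Both states lie at the same level, the angular momentum moves by `±n`, and it is confined to an
interval of length `2 L₀⁽²⁾`. -/
theorem sigma_pow_le {c₂ : ℝ} {x : Elem} (hx : x = .sigP ∨ x = .sigM) {n : ℕ} {t s : Label}
    (h : (x.op c₂ ^ n) (ket t) s ≠ 0) : n ≤ 2 * s.L0 := by
  have he : s.energy = t.energy + n * x.charge := (energy_op c₂ x).pow n t s h
  have hs := abs_le.1 (abs_angular_le s)
  have ht := abs_le.1 (abs_angular_le t)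
  have e := energy_eq s
  rcases hx with rfl | rfl
  · have ha := angular_sigmaPlus.pow n t s h
    simp only [Elem.charge] at he
    omega
  · have ha := angular_sigmaMinus.pow n t s h
    simp only [Elem.charge] at he
    omega

theorem spin_pow_le {c₂ : ℝ} {x : Elem} (hx : x = .sP ∨ x = .sM) {n : ℕ} {t s : Label}
    (h : (x.op c₂ ^ n) (ket t) s ≠ 0) : n ≤ 2 * s.S := by
  have hS : (s.S : ℤ) = t.S + n * 0 := (spin_op c₂ x).pow n t s h
  have hs := s.hl
  have ht := t.hl
  rcases hx with rfl | rfl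
  · have ha : s.lower = t.lower + n * (-1) :=
      (shifts_spinPlus (q := Label.lower) (c := -1) fun _ _ => rfl).pow n t s h
    omega
  · have ha : s.lower = t.lower + n * 1 :=
      (shifts_spinMinus (q := Label.lower) (c := 1) fun _ _ => rfl).pow n t s h
    omega

/-- In a product ordered by the sign of the charge, a nonzero matrix element bounds the total
amount raised, and the powers of `Σ±` by what is left of `L₀⁽²⁾`. -/
theorem exponent_bounds (c₂ : ℝ) (e : Elem → ℕ) (l : List Elem)
    (hl : l.Pairwise fun x y => SignType.sign y.charge ≤ SignType.sign x.charge) (t s : Label)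
    (h : (l.map fun x => x.op c₂ ^ e x).prod (ket t) s ≠ 0) :
    s.S = t.S ∧
    s.L0 + (l.map fun x => e x * (-x.charge).toNat).sum =
      t.L0 + (l.map fun x => e x * x.charge.toNat).sum ∧
    (l.map fun x => e x * x.charge.toNat).sum ≤ s.L0 ∧
    (∀ x ∈ l, x = .sigP ∨ x = .sigM →
      e x + 2 * (l.map fun x => e x * x.charge.toNat).sum ≤ 2 * s.L0) ∧
    (∀ x ∈ l, x = .sP ∨ x = .sM → e x ≤ 2 * s.S) := by
  induction l generalizing s with
  | nil =>
    obtain rfl := eq_of_ket_ne_zero (t := t) (s := s) (by simpa using h)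
    simp
  | cons x l ih =>
    rw [List.map_cons, List.prod_cons] at h
    rw [List.pairwise_cons] at hl
    obtain ⟨r, h1, h2⟩ := exists_intermediate h
    obtain ⟨i1, i2, i3, i4, i5⟩ := ih hl.2 r h1
    have hE : s.energy = r.energy + e x * x.charge := (energy_op c₂ x).pow _ r s h2
    have hS : (s.S : ℤ) = r.S + e x * 0 := (spin_op c₂ x).pow _ r s h2
    rw [energy_eq, energy_eq] at hE
    have hS' : s.S = r.S := by omega
    simp only [List.map_cons, List.sum_cons, List.mem_cons]
    -- This is where the ordering enters: to the right of a neutral or lowering operator nothing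
    -- raises.
    have hzero (hx : x.charge ≤ 0) : (l.map fun x => e x * x.charge.toNat).sum = 0 := by
      refine List.sum_eq_zero fun m hm => ?_
      obtain ⟨y, hy, rfl⟩ := List.mem_map.1 hm
      have hy' : y.charge ≤ 0 := by
        have := (hl.1 y hy).trans (sign_nonpos_iff.2 hx)
        exact sign_nonpos_iff.1 this
      simp [hy']
    have hcast : (e x * x.charge : ℤ) =
        (e x * x.charge.toNat : ℕ) - (e x * (-x.charge).toNat : ℕ) := by
      push_cast
      rw [← mul_sub, Int.toNat_sub_toNat_neg]
    have hnonneg (hx : 0 ≤ x.charge) : e x * (-x.charge).toNat = 0 := by simp [hx]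
    have hnonpos (hx : x.charge ≤ 0) : e x * x.charge.toNat = 0 := by simp [hx]
    have hsig : x = .sigP ∨ x = .sigM → x.charge = 0 := by rintro (rfl | rfl) <;> rfl
    refine ⟨by omega, by omega, ?_, ?_, ?_⟩
    · rcases le_total x.charge 0 with hx | hx
      · have := hzero hx
        have := hnonpos hx
        omega
      · have := hnonneg hx
        omega
    · rintro y (rfl | hy) hy'
      · have := hzero (hsig hy').le
        have := hnonpos (hsig hy').le
        have := sigma_pow_le hy' h2
        omega
      -- A factor to the left of `Σ±` is raising or neutral, so it increases `s.L0` and the amount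
      -- raised equally.
      · have hxs : 0 ≤ x.charge := by
          have hc : y.charge = 0 := by rcases hy' with rfl | rfl <;> rfl
          have := hl.1 y hy
          rw [hc, sign_zero] at this
          exact sign_nonneg_iff.1 this
        have := hnonneg hxs
        have := i4 y hy hy'
        omega
    · rintro y (rfl | hy) hy'
      · exact spin_pow_le hy' h2
      · exact hS' ▸ i5 y hy hy'

/-! ### Comparison of weights and vanishing of matrix elements. -/

theorem weight_eq_sum {l : List Elem} (hn : l.Nodup) (hc : ∀ x, x ∈ l) (w : Elem → ℕ)
    (e : Elem →₀ ℕ) : Finsupp.weight w e = (l.map fun x => e x * w x).sum := by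
  rw [Finsupp.weight_apply, Finsupp.sum_of_support_subset e (s := l.toFinset)
    (fun x _ => List.mem_toFinset.2 (hc x)) _ (by simp), List.sum_toFinset _ hn]
  rfl

theorem weight_one_zero (e : Elem →₀ ℕ) : Finsupp.weight (Elem.weight 1 0) e =
    Finsupp.weight (fun x => x.charge.toNat) e +
      Finsupp.weight (fun x => (-x.charge).toNat) e := by
  simp only [Finsupp.weight_apply, Finsupp.sum, ← Finset.sum_add_distrib, smul_eq_mul, ← mul_add]
  refine Finset.sum_congr rfl fun x _ => congrArg (e x * ·) ?_
  simp only [Elem.weight]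
  omega

theorem weight_two_one (e : Elem →₀ ℕ) : Finsupp.weight (Elem.weight 2 1) e =
    2 * Finsupp.weight (Elem.weight 1 0) e + (e .sigP + e .sigM + e .sP + e .sM) := by
  induction e using Finsupp.induction_linear with
  | zero => simp
  | add u v hu hv =>
    simp only [map_add, Finsupp.add_apply, hu, hv]
    ring
  | single x n =>
    simp only [Finsupp.weight_single]
    cases x <;> simp [Elem.weight, Elem.charge] <;> ring

theorem weight_le_of_orderedMonomial_ne_zero {c₂ : ℝ} {l : List Elem} (hl : IsNormalOrdering l)
    {e : Elem →₀ ℕ} {t s : Label} (h : orderedMonomial c₂ l e (ket t) s ≠ 0) :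
    Finsupp.weight (Elem.weight 1 0) e ≤ s.L0 + t.L0 ∧
      Finsupp.weight (Elem.weight 2 1) e ≤ 2 * (s.L0 + t.L0) + 4 * s.S := by
  obtain ⟨hn, hc, hp, -⟩ := hl
  obtain ⟨-, h2, h3, h4, h5⟩ := exponent_bounds c₂ e l hp t s h
  simp only [← weight_eq_sum hn hc] at h2 h3 h4
  have g1 := h4 .sigP (hc _) (by simp)
  have g2 := h4 .sigM (hc _) (by simp)
  have g3 := h5 .sP (hc _) (by simp)
  have g4 := h5 .sM (hc _) (by simp)
  -- The `Σ±` exponents add up to at most `4M = 2(N₁ - R) + 2(N₂ - L)`, which cancels `2(R + L)`;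
  -- this is why the ratio `2 : 1` of weights is chosen.
  rw [weight_two_one, weight_one_zero]
  omega

theorem normalOrdered_P_apply_eq_zero {c₂ : ℝ} {l : List Elem} (hl : IsNormalOrdering l) {n : ℕ}
    {t s : Label} (h : (n : ℝ) > min (1 + ((s.L0 : ℝ) + t.L0) / 2)
      ((4 + 2 * ((s.L0 : ℝ) + t.L0) + 4 * s.S) / 5)) :
    normalOrdered c₂ l (P n) (ket t) s = 0 := by
  by_contra hne
  simp only [normalOrdered, LinearMap.sum_apply, LinearMap.smul_apply,
    Finsupp.finsetSum_apply] at hne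
  obtain ⟨e, he, hne⟩ := Finset.exists_ne_zero_of_sum_ne_zero hne
  have hw := weight_le_of_orderedMonomial_ne_zero hl (right_ne_zero_of_mul hne)
  have he' := MvPolynomial.mem_support_iff.1 he
  -- The lower bounds are `2(n-1)` and `1 + 5(n-1)`.
  have w1 := (weightGE_P (α := 1) (ν := 0) (by omega) n e he').trans hw.1
  have w2 := (weightGE_P (α := 2) (ν := 1) (by omega) n e he').trans hw.2
  have w1' : 2 * n ≤ 2 + (s.L0 + t.L0) := by omega
  have w2' : 5 * n ≤ 4 + 2 * (s.L0 + t.L0) + 4 * s.S := by omega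
  have w1'' : (2 * n : ℝ) ≤ 2 + (s.L0 + t.L0) := by exact_mod_cast w1'
  have w2'' : (5 * n : ℝ) ≤ 4 + 2 * (s.L0 + t.L0) + 4 * s.S := by exact_mod_cast w2'
  rcases min_lt_iff.1 h with h | h <;> linarith

theorem diag_mul_apply (x : Label → ℝ) (T : Op) (ψ : Space) (s : Label) :
    (diag x * T) ψ s = x s * T ψ s := by
  classical
  rw [Module.End.mul_apply, diag, ofBasis, Finsupp.linearCombination_apply, Finsupp.sum_apply,
    Finsupp.sum, Finset.sum_eq_single s]
  · simp [ket, mul_comm]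
  · intro r _ hr
    simp [ket, Finsupp.single_eq_of_ne hr.symm]
  · intro hs
    simp [Finsupp.notMem_support_iff.1 hs]

theorem braket_eq_zero {A B : Set Label} {T : Op} (h : ∀ s ∈ A, ∀ t ∈ B, T (ket t) s = 0)
    {φ ψ : Space} (hφ : φ ∈ Finsupp.supported ℂ ℂ A) (hψ : ψ ∈ Finsupp.supported ℂ ℂ B) :
    braket φ (T ψ) = 0 := by
  refine Finset.sum_eq_zero fun s hs => ?_
  have : T ψ s = 0 := by
    rw [apply_eq_sum, Finsupp.sum_apply]
    exact Finset.sum_eq_zero fun t ht => by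
      simp [h s ((Finsupp.mem_supported ℂ φ).1 hφ hs) t ((Finsupp.mem_supported ℂ ψ).1 hψ ht)]
  simp [this]

end LCString

theorem lemma5 (c₁ c₂ : ℝ) (hc₁ : ∀ k : ℕ, (k : ℝ) + c₁ ≠ 0) (hc₂ : 0 < c₂)
    (l : List LCString.Elem) (hl : LCString.IsNormalOrdering l) :
    (∀ N₁ N₂ S n : ℕ,
      (n : ℝ) > min (1 + ((N₁ : ℝ) + N₂) / 2) ((4 + 2 * ((N₁ : ℝ) + N₂) + 4 * S) / 5) →
      ∀ φ ∈ LCString.level N₁ S, ∀ ψ ∈ LCString.level N₂ S,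
        LCString.braket φ (LCString.normalOrdered c₂ l (LCString.P n) ψ) = 0) ∧
    (∀ N S n : ℕ,
      (n : ℝ) > min (1 + (N : ℝ)) ((4 + 4 * (N : ℝ) + 4 * S) / 5) →
      ∀ φ ∈ LCString.cutoff N S, ∀ ψ ∈ LCString.cutoff N S,
        LCString.braket φ (LCString.alphaTerm c₁ c₂ l n ψ) = 0) := by
  refine ⟨fun N₁ N₂ S n h φ hφ ψ hψ => ?_, fun N S n h φ hφ ψ hψ => ?_⟩
  · refine LCString.braket_eq_zero ?_ hφ hψ
    rintro s ⟨rfl, rfl⟩ t ⟨rfl, -⟩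
    exact LCString.normalOrdered_P_apply_eq_zero hl h
  · refine LCString.braket_eq_zero ?_ hφ hψ
    rintro s ⟨hs, rfl⟩ t ⟨ht, -⟩
    rw [LCString.alphaTerm, LCString.diag_mul_apply,
      LCString.normalOrdered_P_apply_eq_zero hl, mul_zero]
    -- The threshold increases with both levels, so it is largest at `N₁ = N₂ = N`.
    refine lt_of_le_of_lt ?_ h
    have hs' : (s.L0 : ℝ) ≤ N := by exact_mod_cast hs
    have ht' : (t.L0 : ℝ) ≤ N := by exact_mod_cast ht
    exact min_le_min (by linarith) (by linarith)
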